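/- Let $p\colon E\to B$ be a (Serre) fibration of topological spaces, let $R$ be a commutative ring with unit, write $H^*(X)=\bigoplus_{n\ge 0}H^n(X;R)$ for singular cohomology, and let $u\in H^*(B)$ be nonzero. For a map $q\colon E'\to B'$ let $\mathfrak{genus}(q)\in\{0,1,2,\dots,\infty\}$ be the least $k$ such that $B'$ is covered by $k$ open subsets, on each of which $q$ has a continuous local section ($\infty$ if there is no such $k$). The weight of $u$ with respect to $p$ is $$\mathrm{wgt}_p(u)=\sup\{k\ge 0\mid f^*(u)=0\text{ for all spaces }A\text{ and all maps }f\colon A\to B\text{ with }\mathfrak{genus}(f^*p)\le k\},$$ where $f^*p\colon A\times_B E\to A$ is the pull-back of $p$ along $f$; the supremum is taken in $\{0,1,2,\dots,\infty\}$. For $k\ge 0$ the $k$-fold iterated fibred join $p(k)\colon E(k)\to B$ is defined as follows. The set $E(k)$ consists of the formal sums $e_1t_1+\dots+e_kt_k$ with $e_i\in E$, $t_i\in[0,1]$, $\sum_i t_i=1$ and $p(e_1)=\dots=p(e_k)$, where two sums $\sum_i e_it_i$ and $\sum_i e_i't_i'$ are identified if and only if $t_i=t_i'$ for all $i$ and $e_i=e_i'$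 whenever $t_i>0$ (so $E(0)=\emptyset$). It carries the smallest topology for which all co-ordinate maps $t_i\colon E(k)\to[0,1]$ and $e_i\colon t_i^{-1}(0,1]\to E$ are continuous, and $p(k)(e_1t_1+\dots+e_kt_k)=p(e_1)=\dots=p(e_k)$. Then $$\mathrm{wgt}_p(u)=\sup\{k\ge 0\mid p(k)^*(u)=0\}.$$ In particular, $\mathrm{wgt}_p(u)\ge 1$ if and only if $p^*(u)=0$. -/

import Mathlib

open scoped DirectSum

universe u v w

noncomputable section

namespace FibWeight

/-! ### Singular cohomology with coefficients in a commutative ring -/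

section Cohomology

theorem succAbove_aux {n : ℕ} {i j : Fin (n + 2)} (h : i ≤ j) (a : Fin (n+1)) :
   j.succ.succAbove (i.succAbove a) = i.castSucc.succAbove (j.succAbove a) := by
  simp only [Fin.succAbove, Fin.lt_def, Fin.le_def, Fin.ext_iff] at *
  grind [Fin.val_castSucc]

theorem dd_aux {R : Type*} [CommRing R] (n : ℕ) (F : Fin (n+3) → Fin (n+2) → R)
   (hF : ∀ i j : Fin (n+2), i ≤ j → F j.succ i = F i.castSucc j) :
   ∑ j : Fin (n+3), (-1:R)^(j:ℕ) * ∑ i : Fin (n+2), (-1:R)^(i:ℕ) * F j i = 0 := by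
  have e1 : ∀ i : Fin (n+2), ∑ j : Fin (n+3), (-1:R)^((j:ℕ)+(i:ℕ)) * F j i
     = ∑ j : Fin (n+2), (if i ≤ j then (-1:R)^((j:ℕ)+1+(i:ℕ)) * F j.succ i else 0)
      + ∑ j : Fin (n+2), (if j ≤ i then (-1:R)^((j:ℕ)+(i:ℕ)) * F j.castSucc i else 0) := by
    intro i
    have : ∀ j : Fin (n+3), (-1:R)^((j:ℕ)+(i:ℕ)) * F j i =
      (if i.castSucc < j then (-1:R)^((j:ℕ)+(i:ℕ)) * F j i else 0) + (if j ≤ i.castSucc then (-1:R)^((j:ℕ)+(i:ℕ)) * F j i else 0) := by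
      intro j
      by_cases h : j ≤ i.castSucc
      · simp [h, not_lt.2 h]
      · simp [h, not_le.1 h]
    rw [Finset.sum_congr rfl fun j _ => this j, Finset.sum_add_distrib, Fin.sum_univ_succ]
    congr 1
    · rw [if_neg (Fin.not_lt_zero _), zero_add]
      refine Finset.sum_congr rfl fun j _ => ?_
      simp only [Fin.castSucc_lt_succ_iff, Fin.val_succ]
    · rw [Fin.sum_univ_castSucc]
      rw [if_neg (not_le.2 (Fin.castSucc_lt_last i)), add_zero]
      refine Finset.sum_congr rfl fun j _ => ?_
      simp only [Fin.castSucc_le_castSucc_iff, Fin.val_castSucc]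
  simp only [Finset.mul_sum, ← mul_assoc, ← pow_add]
  rw [Finset.sum_comm, Finset.sum_congr rfl fun i _ => e1 i, Finset.sum_add_distrib]
  rw [Finset.sum_comm, ← Finset.sum_add_distrib]
  refine Finset.sum_eq_zero fun a _ => ?_
  rw [← Finset.sum_add_distrib]
  refine Finset.sum_eq_zero fun b _ => ?_
  by_cases h : b ≤ a
  · simp only [h, if_true, hF b a h]; ring
  · simp [h]

/-- Singular `n`-simplices of `X`: continuous maps from the standard topological `n`-simplex. -/
abbrev Simplex (n : ℕ) (X : Type u) [TopologicalSpace X] : Type u :=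
  C(stdSimplex ℝ (Fin (n + 1)), X)

/-- The `i`-th coface inclusion of the standard `n`-simplex into the standard `(n+1)`-simplex
(the affine map that sends vertices to vertices in increasing order and omits the `i`-th one). -/
def coface {n : ℕ} (i : Fin (n + 2)) :
    C(stdSimplex ℝ (Fin (n + 1)), stdSimplex ℝ (Fin (n + 2))) :=
  ⟨stdSimplex.map i.succAbove, stdSimplex.continuous_map _⟩

variable (R : Type w) [CommRing R]
variable (X : Type u) [TopologicalSpace X] {Y : Type v} [TopologicalSpace Y]

/-- Singular `n`-cochains: `R`-valued functions on the set of singular `n`-simplices, that is,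
homomorphisms from the free abelian group on the singular simplices to `R`. -/
abbrev Cochain (n : ℕ) : Type (max u w) := Simplex n X → R

/-- The singular coboundary `(d c)(s) = ∑ i, (-1)^i c(s ∘ δ_i)`. -/
def coboundary (n : ℕ) : Cochain R X n →ₗ[R] Cochain R X (n + 1) where
  toFun c s := ∑ i : Fin (n + 2), (-1 : R) ^ (i : ℕ) * c (s.comp (coface i))
  map_add' c c' := by
    funext s
    simp [mul_add, Finset.sum_add_distrib]
  map_smul' r c := by
    funext s
    simp only [Pi.smul_apply, smul_eq_mul, RingHom.id_apply, Finset.mul_sum]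
    exact Finset.sum_congr rfl fun i _ => by ring

variable {X} in
theorem comp_coface_comp_coface {n : ℕ} (s : Simplex (n + 2) X) {i j : Fin (n + 2)} (h : i ≤ j) :
    (s.comp (coface j.succ)).comp (coface i) = (s.comp (coface i.castSucc)).comp (coface j) := by
  ext y
  simp only [ContinuousMap.comp_apply, coface, ContinuousMap.coe_mk, stdSimplex.map_comp_apply]
  congr 2
  funext a
  exact succAbove_aux h a

/-- The square of the singular coboundary is zero. -/
theorem coboundary_coboundary (n : ℕ) (c : Cochain R X n) :
    coboundary R X (n + 1) (coboundary R X n c) = 0 := by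
  funext s
  exact dd_aux n (fun j i => c ((s.comp (coface j)).comp (coface i)))
    fun i j h => congrArg c (comp_coface_comp_coface s h)

/-- Singular `n`-cocycles. -/
def cocycles (n : ℕ) : Submodule R (Cochain R X n) := LinearMap.ker (coboundary R X n)

/-- Singular `n`-coboundaries (zero in degree `0`). -/
def coboundaries : (n : ℕ) → Submodule R (Cochain R X n)
  | 0 => ⊥
  | n + 1 => LinearMap.range (coboundary R X n)

/-- `H^n(X; R)`: cocycles modulo coboundaries. -/
abbrev Cohomology (n : ℕ) : Type (max u w) :=
  cocycles R X n ⧸ (coboundaries R X n).submoduleOf (cocycles R X n)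

/-- `H^*(X; R)`, the direct sum of all `H^n(X; R)`. Elements need not be homogeneous. -/
abbrev TotalCohomology : Type (max u w) := ⨁ n : ℕ, Cohomology R X n

variable {X}

/-- The map induced on cochains by a continuous map. -/
def cochainMap (f : C(X, Y)) (n : ℕ) : Cochain R Y n →ₗ[R] Cochain R X n where
  toFun c s := c (f.comp s)
  map_add' _ _ := rfl
  map_smul' _ _ := rfl

theorem coboundary_cochainMap (f : C(X, Y)) (n : ℕ) (c : Cochain R Y n) :
    coboundary R X n (cochainMap R f n c) = cochainMap R f (n + 1) (coboundary R Y n c) := rfl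

theorem cochainMap_mem_cocycles (f : C(X, Y)) (n : ℕ) :
    ∀ c ∈ cocycles R Y n, cochainMap R f n c ∈ cocycles R X n := by
  intro c hc
  have h : coboundary R Y n c = 0 := hc
  change coboundary R X n (cochainMap R f n c) = 0
  rw [coboundary_cochainMap, h, map_zero]

theorem cochainMap_mem_coboundaries (f : C(X, Y)) (n : ℕ) :
    ∀ c ∈ coboundaries R Y n, cochainMap R f n c ∈ coboundaries R X n := by
  intro c hc
  cases n with
  | zero =>
    have h : c = 0 := hc
    rw [h, map_zero]
    exact Submodule.zero_mem _
  | succ n =>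
    obtain ⟨b, rfl⟩ := hc
    exact ⟨cochainMap R f n b, rfl⟩

/-- The map induced on cocycles by a continuous map. -/
def cocycleMap (f : C(X, Y)) (n : ℕ) : cocycles R Y n →ₗ[R] cocycles R X n :=
  (cochainMap R f n).restrict (cochainMap_mem_cocycles R f n)

/-- The induced map `f^* : H^n(Y; R) → H^n(X; R)`. -/
def cohomologyMap (f : C(X, Y)) (n : ℕ) : Cohomology R Y n →ₗ[R] Cohomology R X n :=
  Submodule.mapQ _ _ (cocycleMap R f n) fun c hc =>
    cochainMap_mem_coboundaries R f n c.1 hc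

/-- The induced map `f^* : H^*(Y; R) → H^*(X; R)`. -/
def totalMap (f : C(X, Y)) : TotalCohomology R Y →ₗ[R] TotalCohomology R X :=
  DirectSum.lmap (cohomologyMap R f)

end Cohomology

/-! ### Fibrations, pull-backs, Schwarz genus -/

section Genus

variable {E : Type u} {B : Type v} [TopologicalSpace E] [TopologicalSpace B]

/-- A (Serre) fibration: a map with the homotopy lifting property for all cubes `[0,1]^n`.
In particular every Hurewicz fibration is one. -/
def IsFibration (p : C(E, B)) : Prop :=
  ∀ (n : ℕ) (h : C((Fin n → unitInterval) × unitInterval, B)) (g : C(Fin n → unitInterval, E)),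
    (∀ x, p (g x) = h (x, 0)) →
      ∃ H : C((Fin n → unitInterval) × unitInterval, E), (∀ x, H (x, 0) = g x) ∧ ∀ y, p (H y) = h y

/-- The pull-back `f^*p : A ×_B E → A` of `p : E → B` along `f : A → B`; its total space is
`{(a, e) | f a = p e}`. -/
def pullbackMap {A : Type w} [TopologicalSpace A] (f : C(A, B)) (p : C(E, B)) :
    C(Function.Pullback f p, A) :=
  ⟨fun x => x.1.1, continuous_fst.comp continuous_subtype_val⟩

/-- `B` is covered by `k` open sets (possibly empty), on each of which `p` has a continuous local
section. -/
def HasSectionalCover (p : C(E, B)) (k : ℕ) : Prop :=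
  ∃ U : Fin k → Set B, (∀ i, IsOpen (U i)) ∧ (⋃ i, U i) = Set.univ ∧
    ∀ i, ∃ s : C(U i, E), ∀ x : U i, p (s x) = x

/-- The Schwarz genus: the least `k` for which there is such a cover by `k` sets,
`∞` if there is none. -/
def genus (p : C(E, B)) : ℕ∞ := sInf {m : ℕ∞ | ∃ k : ℕ, m = k ∧ HasSectionalCover p k}

end Genus

/-- The weight of `u ∈ H^*(B; R)` with respect to `p : E → B`: the supremum in `ℕ ∪ {∞}` of all `k`
such that `f^* u = 0` for all maps `f : A → B` with `genus (f^*p) ≤ k`. -/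
def weight {R : Type w} [CommRing R] {E B : Type u} [TopologicalSpace E] [TopologicalSpace B]
    (p : C(E, B)) (x : TotalCohomology R B) : ℕ∞ :=
  sSup {m : ℕ∞ | ∃ k : ℕ, m = k ∧
    ∀ (A : Type u) [TopologicalSpace A] (f : C(A, B)),
      genus (pullbackMap f p) ≤ k → totalMap R f x = 0}

/-! ### Iterated fibred joins -/

section Join

variable {E : Type u} {B : Type v} [TopologicalSpace E] [TopologicalSpace B]

/-- Representatives of the formal sums `e_1 t_1 + ⋯ + e_k t_k`: the `e_i` lie in one fibre of `p`,
the `t_i` are non-negative (hence lie in `[0,1]`) and add up to `1`. -/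
abbrev PreJoin (p : C(E, B)) (k : ℕ) : Type u :=
  {x : (Fin k → E) × stdSimplex ℝ (Fin k) // ∀ i j, p (x.1 i) = p (x.1 j)}

/-- Two formal sums are equal iff they have the same `t_i`, and the same `e_i` whenever
`t_i > 0`. -/
def joinSetoid (p : C(E, B)) (k : ℕ) : Setoid (PreJoin p k) where
  r x y := x.1.2 = y.1.2 ∧ ∀ i, 0 < x.1.2 i → x.1.1 i = y.1.1 i
  iseqv :=
    { refl := fun _ => ⟨rfl, fun _ _ => rfl⟩
      symm := fun h => ⟨h.1.symm, fun i hi => (h.2 i (by rw [h.1]; exact hi)).symm⟩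
      trans := fun h h' =>
        ⟨h.1.trans h'.1, fun i hi => (h.2 i hi).trans (h'.2 i (by rw [← h.1]; exact hi))⟩ }

/-- The total space `E(k)` of the `k`-fold iterated fibred join of `p`. -/
def FibredJoin (p : C(E, B)) (k : ℕ) : Type u := Quotient (joinSetoid p k)

namespace FibredJoin

variable (p : C(E, B)) {k : ℕ}

/-- The co-ordinate `t_i : E(k) → [0,1]`. -/
def t (i : Fin k) : FibredJoin p k → ℝ :=
  Quotient.lift (fun x : PreJoin p k => x.1.2 i) fun _ _ h => by
    have h1 := h.1
    simp only [h1]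

/-- The co-ordinate `e_i`, defined where `t_i > 0`. -/
def e (i : Fin k) (z : {z : FibredJoin p k // 0 < t p i z}) : E :=
  Quotient.hrecOn (motive := fun z => 0 < t p i z → E) z.1 (fun x _ => x.1.1 i)
    (fun x y h => by
      refine Function.hfunext (congrArg (fun z => 0 < t p i z) (Quotient.sound h)) ?_
      intro hx _ _
      exact heq_of_eq (h.2 i hx)) z.2

/-- The smallest topology on `E(k)` for which all `t_i` are continuous and all
`e_i : t_i⁻¹(0,1] → E` are continuous (on the open sets `t_i⁻¹(0,1]`). -/
instance topology : TopologicalSpace (FibredJoin p k) :=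
  TopologicalSpace.generateFrom
    ({S | ∃ (i : Fin k) (V : Set ℝ), IsOpen V ∧ S = t p i ⁻¹' V} ∪
      {S | ∃ (i : Fin k) (W : Set E), IsOpen W ∧ S = Subtype.val '' (e p i ⁻¹' W)})

theorem continuous_t (i : Fin k) : Continuous (t p i) :=
  ⟨fun V hV => TopologicalSpace.isOpen_generateFrom_of_mem (Or.inl ⟨i, V, hV, rfl⟩)⟩

theorem continuous_e (i : Fin k) : Continuous (e p i) := by
  refine ⟨fun W hW => ?_⟩
  refine isOpen_induced_iff.2 ⟨Subtype.val '' (e p i ⁻¹' W),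
    TopologicalSpace.isOpen_generateFrom_of_mem (Or.inr ⟨i, W, hW, rfl⟩), ?_⟩
  exact Set.preimage_image_eq _ Subtype.val_injective

/-- Minimality of the topology: it is coarser than any topology `τ` for which the co-ordinates are
continuous (where `t_i⁻¹(0,1]` carries the subspace topology of `τ`). -/
theorem le_topology (τ : TopologicalSpace (FibredJoin p k))
    (ht : ∀ i : Fin k, @Continuous _ _ τ _ (t p i))
    (he : ∀ i : Fin k, @Continuous _ _ (@instTopologicalSpaceSubtype _ _ τ) _ (e p i)) :
    τ ≤ topology p := by
  refine TopologicalSpace.le_generateFrom_iff_subset_isOpen.2 ?_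
  rintro S (⟨i, V, hV, rfl⟩ | ⟨i, W, hW, rfl⟩)
  · exact @IsOpen.preimage _ _ τ _ _ (ht i) V hV
  · have hpos : @IsOpen _ τ {z | 0 < t p i z} :=
      @IsOpen.preimage _ _ τ _ _ (ht i) (Set.Ioi 0) isOpen_Ioi
    have h2 := @IsOpen.preimage _ _ (@instTopologicalSpaceSubtype _ _ τ) _ _ (he i) W hW
    exact @IsOpen.isOpenMap_subtype_val _ τ _ hpos _ h2

theorem exists_pos (x : PreJoin p k) : ∃ i, 0 < x.1.2 i := by
  by_contra! h
  have h1 : ∑ i, x.1.2 i = 1 := x.1.2.2.2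
  have h2 : ∑ i, x.1.2 i ≤ 0 := Finset.sum_nonpos fun i _ => h i
  linarith

/-- The common value `p e_1 = ⋯ = p e_k`. -/
def proj : FibredJoin p k → B :=
  Quotient.lift (fun x : PreJoin p k => p (x.1.1 (exists_pos p x).choose)) fun x y h => by
    have hx := (exists_pos p x).choose_spec
    change p (x.1.1 _) = p (y.1.1 _)
    rw [h.2 _ hx]
    exact y.2 _ _

theorem proj_mk (x : PreJoin p k) (i : Fin k) :
    proj p (Quotient.mk (joinSetoid p k) x) = p (x.1.1 i) := x.2 _ _

theorem proj_eq (i : Fin k) (z : {z : FibredJoin p k // 0 < t p i z}) :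
    proj p z.1 = p (e p i z) := by
  obtain ⟨z, hz⟩ := z
  induction z using Quotient.inductionOn with
  | h x => exact x.2 _ _

theorem continuous_proj : Continuous (proj p (k := k)) := by
  refine continuous_iff_continuousAt.2 fun z => ?_
  obtain ⟨i, hi⟩ : ∃ i, 0 < t p i z := by
    induction z using Quotient.inductionOn with
    | h x => exact exists_pos p x
  have ho : IsOpen {z : FibredJoin p k | 0 < t p i z} :=
    isOpen_Ioi.preimage (continuous_t p i)
  have hc : ContinuousOn (proj p (k := k)) {z | 0 < t p i z} := by
    rw [continuousOn_iff_continuous_domRestrict]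
    have h : Set.domRestrict {z | 0 < t p i z} (proj p (k := k)) = fun z => p (e p i z) :=
      funext fun z => proj_eq p i z
    rw [h]
    exact p.continuous.comp (continuous_e p i)
  exact hc.continuousAt (ho.mem_nhds hi)

end FibredJoin

/-- The `k`-fold iterated fibred join `p(k) : E(k) → B`,
`p(k)(e_1 t_1 + ⋯ + e_k t_k) = p e_1 = ⋯ = p e_k`. -/
def joinMap (p : C(E, B)) (k : ℕ) : C(FibredJoin p k, B) :=
  ⟨FibredJoin.proj p, FibredJoin.continuous_proj p⟩

end Join

end FibWeight

end

/-! Over `E(k)` the co-ordinates `e_i` are sections of the pulled-back map on the open sets `t_i >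
0`, so `p(k)` is itself one of the test maps in the weight (`hasSectionalCover_joinMap`).
Conversely, let `f : A → B` have local lifts to `E` over an open cover `U_1, …, U_k` of `A`. A
subordinate partition of unity would combine them into a lift `A → E(k)`, but an arbitrary space `A`
need not have one. For cohomology it is enough to lift each singular simplex compatibly with faces
(`totalMap_eq_zero_of_simplex_lift`). This needs partitions of unity on simplices that restrict
correctly to faces; distance functions fail here, since points of a closed set off a face can be
nearer than those on it. The function `contact` replaces them: it is continuous, detects a closed
set by the value `1`, and commutes with face inclusions (`contact_map`). Normalising yields the
lifts of `exists_simplex_lift`. -/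

namespace FibWeight

/-! ### A face-compatible substitute for the distance to a closed subset of a simplex -/

section Contact

open Filter Topology

variable {ι κ : Type*} [Fintype ι] [Fintype κ]

/-- The largest `c ∈ [0,1]` such that `c • z ≤ y` for some `z ∈ C` (and `0` if `C` is empty).
For closed `C` it is continuous in `y`, takes the value `1` exactly on `C`, and it is compatible
with the face inclusions of simplices. -/
noncomputable def contact (C : Set (stdSimplex ℝ ι)) (y : stdSimplex ℝ ι) : ℝ :=
  sSup {c : ℝ | 0 ≤ c ∧ ∃ z ∈ C, ∀ j, c * z j ≤ y j}

theorem le_one_of_mul_le {c : ℝ} {y z : stdSimplex ℝ ι} (h : ∀ j, c * z j ≤ y j) : c ≤ 1 := by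
  have h1 : ∑ j, c * z j ≤ ∑ j, y j := Finset.sum_le_sum fun j _ => h j
  rw [← Finset.mul_sum] at h1
  have hy : ∑ j, y j = 1 := y.2.2
  have hz : ∑ j, z j = 1 := z.2.2
  rw [hy, hz] at h1
  linarith

theorem eq_of_coord_le {y z : stdSimplex ℝ ι} (h : ∀ j, z j ≤ y j) : z = y := by
  have hy : ∑ j, y j = 1 := y.2.2
  have hz : ∑ j, z j = 1 := z.2.2
  have := (Finset.sum_eq_sum_iff_of_le (s := Finset.univ) fun j _ => h j).1 (hz.trans hy.symm)
  ext j
  exact this j (Finset.mem_univ j)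

theorem bddAbove_contact (C : Set (stdSimplex ℝ ι)) (y : stdSimplex ℝ ι) :
    BddAbove {c : ℝ | 0 ≤ c ∧ ∃ z ∈ C, ∀ j, c * z j ≤ y j} :=
  ⟨1, fun _ ⟨_, _, _, h⟩ => le_one_of_mul_le h⟩

theorem contact_nonneg (C : Set (stdSimplex ℝ ι)) (y : stdSimplex ℝ ι) : 0 ≤ contact C y :=
  Real.sSup_nonneg fun _ h => h.1

theorem contact_le_one (C : Set (stdSimplex ℝ ι)) (y : stdSimplex ℝ ι) : contact C y ≤ 1 :=
  Real.sSup_le (fun _ ⟨_, _, _, h⟩ => le_one_of_mul_le h) zero_le_one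

theorem continuous_coord (j : ι) : Continuous fun y : stdSimplex ℝ ι => y j :=
  (continuous_apply j).comp continuous_subtype_val

/-- The supremum is attained by compactness of `[0,1]` times the simplex; positivity excludes the
empty set of candidates, where `sSup` defaults to `0`. -/
theorem exists_contact_mul_le {C : Set (stdSimplex ℝ ι)} (hC : IsClosed C) {y : stdSimplex ℝ ι}
    (h : 0 < contact C y) : ∃ z ∈ C, ∀ j, contact C y * z j ≤ y j := by
  set S := {c : ℝ | 0 ≤ c ∧ ∃ z ∈ C, ∀ j, c * z j ≤ y j} with hS
  have hne : S.Nonempty := by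
    by_contra hne
    rw [Set.not_nonempty_iff_eq_empty] at hne
    rw [contact, ← hS, hne, Real.sSup_empty] at h
    exact lt_irrefl _ h
  have hcl : IsClosed {q : ℝ × stdSimplex ℝ ι | q.2 ∈ C ∧ ∀ j, q.1 * q.2 j ≤ y j} := by
    simp only [Set.ofPred_and, Set.ofPred_forall]
    exact (hC.preimage continuous_snd).inter <| isClosed_iInter fun j => isClosed_le
      (continuous_fst.mul ((continuous_coord j).comp continuous_snd)) continuous_const
  have hcomp : IsCompact S := by
    have := ((isCompact_Icc (a := (0 : ℝ)) (b := 1)).prod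
      (isCompact_univ (X := stdSimplex ℝ ι))).inter_right hcl
    convert this.image continuous_fst
    ext c
    constructor
    · rintro ⟨h0, z, hz, hle⟩
      exact ⟨(c, z), ⟨⟨⟨h0, le_one_of_mul_le hle⟩, trivial⟩, hz, hle⟩, rfl⟩
    · rintro ⟨⟨c, z⟩, ⟨⟨⟨h0, -⟩, -⟩, hz, hle⟩, rfl⟩
      exact ⟨h0, z, hz, hle⟩
  exact (hcomp.sSup_mem hne).2

theorem le_contact_iff {C : Set (stdSimplex ℝ ι)} (hC : IsClosed C) {y : stdSimplex ℝ ι} {c : ℝ}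
    (hc : 0 < c) : c ≤ contact C y ↔ ∃ z ∈ C, ∀ j, c * z j ≤ y j := by
  constructor
  · intro h
    obtain ⟨z, hz, hle⟩ := exists_contact_mul_le hC (hc.trans_le h)
    exact ⟨z, hz, fun j => (mul_le_mul_of_nonneg_right h (z.2.1 j)).trans (hle j)⟩
  · exact fun h => le_csSup (bddAbove_contact C y) ⟨hc.le, h⟩

/-- For fixed `z` the right-hand side is an open condition on `y`, which is what lower
semicontinuity needs. -/
theorem lt_contact_iff {C : Set (stdSimplex ℝ ι)} (hC : IsClosed C) {y : stdSimplex ℝ ι} {c : ℝ}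
    (hc : 0 ≤ c) : c < contact C y ↔ ∃ z ∈ C, ∀ j, 0 < z j → c * z j < y j := by
  constructor
  · intro h
    obtain ⟨z, hz, hle⟩ := exists_contact_mul_le hC (hc.trans_lt h)
    exact ⟨z, hz, fun j hj => (mul_lt_mul_of_pos_right h hj).trans_le (hle j)⟩
  · rintro ⟨z, hz, hlt⟩
    -- Finitely many strict inequalities leave room to enlarge `c` slightly; co-ordinates with `z j
    -- = 0` impose no condition.
    have hev : ∀ᶠ c' in 𝓝[>] c, ∀ j, c' * z j ≤ y j := by
      refine eventually_all.2 fun j => ?_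
      rcases (show 0 ≤ z j from z.2.1 j).eq_or_lt with h0 | h0
      · exact Eventually.of_forall fun c' => by
          rw [← h0, mul_zero]
          exact y.2.1 j
      · have : Tendsto (fun c' => c' * z j) (𝓝[>] c) (𝓝 (c * z j)) :=
          ((continuous_mul_const (z j)).tendsto c).mono_left nhdsWithin_le_nhds
        exact (this.eventually_lt_const (hlt j h0)).mono fun _ h => h.le
    obtain ⟨c', hle, hc'⟩ := (hev.and self_mem_nhdsWithin).exists
    exact (show c < c' from hc').trans_le
      ((le_contact_iff hC (hc.trans_lt hc')).2 ⟨z, hz, hle⟩)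

theorem contact_eq_one_iff {C : Set (stdSimplex ℝ ι)} (hC : IsClosed C) {y : stdSimplex ℝ ι} :
    contact C y = 1 ↔ y ∈ C := by
  rw [← (contact_le_one C y).ge_iff_eq, le_contact_iff hC one_pos]
  constructor
  · rintro ⟨z, hz, h⟩
    rwa [← eq_of_coord_le fun j => (one_mul (z j)).symm.trans_le (h j)]
  · exact fun h => ⟨y, h, fun j => (one_mul _).le⟩

theorem continuous_contact {C : Set (stdSimplex ℝ ι)} (hC : IsClosed C) :
    Continuous (contact C) := by
  rw [continuous_iff_lower_upperSemicontinuous]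
  constructor
  · rw [lowerSemicontinuous_iff_isOpen_preimage]
    intro c
    rcases lt_or_ge c 0 with hc | hc
    · convert isOpen_univ
      exact Set.eq_univ_of_forall fun y => hc.trans_le (contact_nonneg C y)
    · have : contact C ⁻¹' Set.Ioi c =
          ⋃ z ∈ C, ⋂ j, ⋂ _ : 0 < z j, {y : stdSimplex ℝ ι | c * z j < y j} := by
        ext y
        simpa using lt_contact_iff hC hc
      rw [this]
      refine isOpen_biUnion fun z _ => isOpen_iInter_of_finite fun j =>
        isOpen_iInter_of_finite fun _ => ?_
      exact isOpen_lt continuous_const (continuous_coord j)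
  · rw [upperSemicontinuous_iff_isClosed_preimage]
    intro c
    rcases le_or_gt c 0 with hc | hc
    · convert isClosed_univ
      exact Set.eq_univ_of_forall fun y => hc.trans (contact_nonneg C y)
    -- The superlevel set is the projection of this closed set along a compact factor, hence closed.
    · have hcl : IsClosed {q : stdSimplex ℝ ι × stdSimplex ℝ ι |
          q.2 ∈ C ∧ ∀ j, c * q.2 j ≤ q.1 j} := by
        simp only [Set.ofPred_and, Set.ofPred_forall]
        exact (hC.preimage continuous_snd).inter <| isClosed_iInter fun j => isClosed_le
          (continuous_const.mul ((continuous_coord j).comp continuous_snd))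
          ((continuous_coord j).comp continuous_fst)
      convert isClosedMap_fst_of_compactSpace _ hcl
      ext y
      simpa using le_contact_iff hC hc

theorem map_coord_of_injective {φ : ι → κ} (hφ : Function.Injective φ) (y : stdSimplex ℝ ι)
    (i : ι) : stdSimplex.map φ y (φ i) = y i := by
  classical
  rw [stdSimplex.map_coe, FunOnFinite.linearMap_apply_apply]
  simp [hφ.eq_iff, Finset.sum_filter]

theorem map_coord_of_notMem_range {φ : ι → κ} (y : stdSimplex ℝ ι) {j : κ}
    (hj : j ∉ Set.range φ) : stdSimplex.map φ y j = 0 := by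
  classical
  rw [stdSimplex.map_coe, FunOnFinite.linearMap_apply_apply]
  refine Finset.sum_eq_zero fun i hi => ?_
  exact absurd ⟨i, (Finset.mem_filter.1 hi).2⟩ hj

theorem exists_map_eq {φ : ι → κ} (hφ : Function.Injective φ) (z : stdSimplex ℝ κ)
    (hz : ∀ j, j ∉ Set.range φ → z j = 0) : ∃ y, stdSimplex.map φ y = z := by
  refine ⟨⟨fun i => z (φ i), fun i => z.2.1 _, ?_⟩, ?_⟩
  · exact (Fintype.sum_of_injective φ hφ _ _ hz fun _ => rfl).trans z.2.2
  · ext j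
    by_cases hj : j ∈ Set.range φ
    · obtain ⟨i, rfl⟩ := hj
      exact map_coord_of_injective hφ _ i
    · rw [map_coord_of_notMem_range _ hj, hz j hj]

/-- If `c > 0` and `c • z` is bounded by a point of a face, then `z` vanishes off that face; so only
the part of `C` on the face competes. -/
theorem contact_map {φ : ι → κ} (hφ : Function.Injective φ) {C : Set (stdSimplex ℝ κ)}
    (hC : IsClosed C) (y : stdSimplex ℝ ι) :
    contact C (stdSimplex.map φ y) = contact (stdSimplex.map φ ⁻¹' C) y := by
  have hC' : IsClosed (stdSimplex.map φ ⁻¹' C) := hC.preimage (stdSimplex.continuous_map φ)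
  have key : ∀ c : ℝ, 0 < c →
      (c ≤ contact C (stdSimplex.map φ y) ↔ c ≤ contact (stdSimplex.map φ ⁻¹' C) y) := by
    intro c hc
    rw [le_contact_iff hC hc, le_contact_iff hC' hc]
    constructor
    · rintro ⟨z, hz, h⟩
      obtain ⟨x, rfl⟩ := exists_map_eq hφ z fun j hj => by
        have h1 := h j
        rw [map_coord_of_notMem_range _ hj] at h1
        exact le_antisymm (nonpos_of_mul_nonpos_right h1 hc) (z.2.1 j)
      refine ⟨x, hz, fun i => ?_⟩
      have h1 := h (φ i)
      rwa [map_coord_of_injective hφ, map_coord_of_injective hφ] at h1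
    · rintro ⟨x, hx, h⟩
      refine ⟨_, hx, fun j => ?_⟩
      by_cases hj : j ∈ Set.range φ
      · obtain ⟨i, rfl⟩ := hj
        rw [map_coord_of_injective hφ, map_coord_of_injective hφ]
        exact h i
      · rw [map_coord_of_notMem_range _ hj, map_coord_of_notMem_range _ hj, mul_zero]
  refine eq_of_forall_le_iff fun c => ?_
  rcases le_or_gt c 0 with hc | hc
  · exact iff_of_true (hc.trans (contact_nonneg _ _)) (hc.trans (contact_nonneg _ _))
  · exact key c hc

end Contact

/-! ### Cohomology sees only face-compatible lifts of simplices -/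

section Lift

variable {R : Type w} [CommRing R] {A B Y : Type*} [TopologicalSpace A] [TopologicalSpace B]
  [TopologicalSpace Y]

/-- A class on `B` that vanishes on `Y` vanishes on `A` as soon as the singular simplices of `A`
lift to `Y` over `B` compatibly with the face maps. -/
theorem totalMap_eq_zero_of_simplex_lift (f : C(A, B)) (g : C(Y, B))
    (Φ : ∀ n, Simplex n A → Simplex n Y)
    (hface : ∀ n (s : Simplex (n + 1) A) i, Φ n (s.comp (coface i)) = (Φ (n + 1) s).comp (coface i))
    (hlift : ∀ n (s : Simplex n A), g.comp (Φ n s) = f.comp s)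
    (x : TotalCohomology R B) (hx : totalMap R g x = 0) : totalMap R f x = 0 := by
  refine DirectSum.ext fun n => ?_
  have hn : cohomologyMap R g n (x n) = 0 := by
    have := DFunLike.congr_fun hx n
    rwa [totalMap, DirectSum.lmap_apply] at this
  rw [totalMap, DirectSum.lmap_apply]
  change cohomologyMap R f n (x n) = 0
  obtain ⟨c, hc⟩ := Submodule.Quotient.mk_surjective _ (x n)
  rw [← hc] at hn ⊢
  have hg : cochainMap R g n c.1 ∈ coboundaries R Y n :=
    (Submodule.Quotient.mk_eq_zero ((coboundaries R Y n).submoduleOf (cocycles R Y n))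
      (x := cocycleMap R g n c)).1 hn
  refine (Submodule.Quotient.mk_eq_zero ((coboundaries R A n).submoduleOf (cocycles R A n))
    (x := cocycleMap R f n c)).2 ?_
  change cochainMap R f n c.1 ∈ coboundaries R A n
  have hfg : cochainMap R f n c.1 = fun s => cochainMap R g n c.1 (Φ n s) := by
    funext s
    exact congrArg c.1 (hlift n s).symm
  rw [hfg]
  cases n with
  | zero =>
    have h0 : cochainMap R g 0 c.1 = 0 := hg
    rw [h0]
    exact Submodule.zero_mem _
  | succ n =>
    obtain ⟨b, hb⟩ := hg
    -- A primitive on `Y` is transported along `Φ`; its coboundary involves only faces, so `hface`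
    -- suffices.
    refine ⟨fun s => b (Φ n s), ?_⟩
    rw [← hb]
    funext s
    simp only [coboundary, LinearMap.coe_mk, AddHom.coe_mk, hface]

theorem totalMap_comp_eq_zero (f : C(A, Y)) (g : C(Y, B)) (x : TotalCohomology R B)
    (hx : totalMap R g x = 0) : totalMap R (g.comp f) x = 0 :=
  totalMap_eq_zero_of_simplex_lift (g.comp f) g (fun _ s => f.comp s) (fun _ _ _ => rfl)
    (fun _ _ => rfl) x hx

end Lift

/-! ### Sectional covers, genus and local lifts -/

section Cover

variable {E B : Type*} [TopologicalSpace E] [TopologicalSpace B]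

theorem HasSectionalCover.mono {p : C(E, B)} {m k : ℕ} (hmk : m ≤ k)
    (h : HasSectionalCover p m) : HasSectionalCover p k := by
  obtain ⟨U, hU, hcov, hs⟩ := h
  refine ⟨fun i => if hi : (i : ℕ) < m then U ⟨i, hi⟩ else ∅, fun i => ?_, ?_, fun i => ?_⟩
  · dsimp only
    split_ifs
    exacts [hU _, isOpen_empty]
  · refine Set.eq_univ_of_forall fun b => ?_
    obtain ⟨i, hi⟩ := Set.mem_iUnion.1 (hcov ▸ Set.mem_univ b)
    refine Set.mem_iUnion.2 ⟨Fin.castLE hmk i, ?_⟩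
    simpa using hi
  · by_cases hi : (i : ℕ) < m
    · beta_reduce
      rw [dif_pos hi]
      exact hs _
    · beta_reduce
      rw [dif_neg hi]
      exact ⟨⟨fun z => z.2.elim, continuous_of_const fun z => z.2.elim⟩, fun z => z.2.elim⟩

theorem genus_le_iff {p : C(E, B)} {k : ℕ} : genus p ≤ k ↔ HasSectionalCover p k := by
  constructor
  · intro h
    -- A finite bound excludes the empty set, whose infimum is `⊤`.
    have hne : {m : ℕ∞ | ∃ k : ℕ, m = k ∧ HasSectionalCover p k}.Nonempty := by
      by_contra hne
      rw [Set.not_nonempty_iff_eq_empty] at hne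
      rw [genus, hne, sInf_empty] at h
      exact ENat.natCast_ne_top k (top_le_iff.1 h)
    obtain ⟨m, hm, hc⟩ := csInf_mem hne
    have hmk : ((m : ℕ) : ℕ∞) ≤ k := hm ▸ h
    exact hc.mono (Nat.cast_le.1 hmk)
  · exact fun h => sInf_le ⟨k, rfl, h⟩

variable {A : Type*} [TopologicalSpace A]

theorem hasSectionalCover_pullback_iff {f : C(A, B)} {p : C(E, B)} {k : ℕ} :
    HasSectionalCover (pullbackMap f p) k ↔
      ∃ U : Fin k → Set A, (∀ i, IsOpen (U i)) ∧ (⋃ i, U i) = Set.univ ∧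
        ∀ i, ∃ s : C(U i, E), ∀ a : U i, p (s a) = f a := by
  refine exists_congr fun U => and_congr_right fun _ => and_congr_right fun _ =>
    forall_congr' fun i => ⟨?_, ?_⟩
  · rintro ⟨s, hs⟩
    refine ⟨⟨fun a => (s a).1.2, continuous_snd.comp (continuous_subtype_val.comp s.continuous)⟩,
      fun a => ?_⟩
    exact (s a).2.symm.trans (congrArg f (hs a))
  · rintro ⟨s, hs⟩
    exact ⟨⟨fun a => ⟨(a.1, s a), (hs a).symm⟩,
      (continuous_subtype_val.prodMk s.continuous).subtype_mk _⟩, fun _ => rfl⟩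

theorem hasSectionalCover_joinMap (p : C(E, B)) (k : ℕ) :
    HasSectionalCover (pullbackMap (joinMap p k) p) k := by
  refine hasSectionalCover_pullback_iff.2
    ⟨fun i => {z | 0 < FibredJoin.t p i z}, fun i => isOpen_Ioi.preimage (FibredJoin.continuous_t p i),
      Set.eq_univ_of_forall fun z => ?_, fun i =>
      ⟨⟨FibredJoin.e p i, FibredJoin.continuous_e p i⟩, fun z => (FibredJoin.proj_eq p i z).symm⟩⟩
  induction z using Quotient.inductionOn with
  | h x => exact Set.mem_iUnion.2 (FibredJoin.exists_pos p x)

theorem hasSectionalCover_one_iff {f : C(A, B)} {p : C(E, B)} :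
    HasSectionalCover (pullbackMap f p) 1 ↔ ∃ g : C(A, E), p.comp g = f := by
  rw [hasSectionalCover_pullback_iff]
  constructor
  · rintro ⟨U, -, hcov, hs⟩
    have hU : ∀ a, a ∈ U 0 := fun a => by
      obtain ⟨i, hi⟩ := Set.mem_iUnion.1 (hcov ▸ Set.mem_univ a)
      rwa [Subsingleton.elim 0 i]
    obtain ⟨s, hs⟩ := hs 0
    exact ⟨s.comp ⟨fun a => ⟨a, hU a⟩, continuous_id.subtype_mk hU⟩,
      ContinuousMap.ext fun a => hs ⟨a, hU a⟩⟩
  · rintro ⟨g, rfl⟩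
    exact ⟨fun _ => Set.univ, fun _ => isOpen_univ, Set.iUnion_const _, fun _ =>
      ⟨g.comp ⟨Subtype.val, continuous_subtype_val⟩, fun _ => rfl⟩⟩

end Cover

/-! ### Lifting singular simplices to the fibred join -/

section SimplexLift

variable {E B A : Type*} [TopologicalSpace E] [TopologicalSpace B] [TopologicalSpace A]

/-- The normalised functions `1 - contact (s⁻¹ Uᵢᶜ)`: a partition of unity on the simplex whose
`i`-th member is positive exactly on `s⁻¹ Uᵢ`. -/
noncomputable def coverWeight {k n : ℕ} (U : Fin k → Set A) (s : Simplex n A) (i : Fin k)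
    (y : stdSimplex ℝ (Fin (n + 1))) : ℝ :=
  (1 - contact (s ⁻¹' (U i)ᶜ) y) / ∑ j, (1 - contact (s ⁻¹' (U j)ᶜ) y)

variable {k : ℕ} {U : Fin k → Set A}

theorem one_sub_contact_pos_iff {n : ℕ} (hU : ∀ i, IsOpen (U i)) (s : Simplex n A) (i : Fin k)
    (y : stdSimplex ℝ (Fin (n + 1))) : 0 < 1 - contact (s ⁻¹' (U i)ᶜ) y ↔ s y ∈ U i := by
  rw [sub_pos, (contact_le_one _ _).lt_iff_ne, Ne,
    contact_eq_one_iff ((hU i).isClosed_compl.preimage s.continuous)]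
  simp

theorem sum_one_sub_contact_pos {n : ℕ} (hU : ∀ i, IsOpen (U i)) (hcov : (⋃ i, U i) = Set.univ)
    (s : Simplex n A) (y : stdSimplex ℝ (Fin (n + 1))) :
    0 < ∑ j, (1 - contact (s ⁻¹' (U j)ᶜ) y) := by
  obtain ⟨i, hi⟩ := Set.mem_iUnion.1 (hcov ▸ Set.mem_univ (s y))
  exact Finset.sum_pos' (fun j _ => sub_nonneg.2 (contact_le_one _ _))
    ⟨i, Finset.mem_univ i, (one_sub_contact_pos_iff hU s i y).2 hi⟩

theorem coverWeight_pos_iff {n : ℕ} (hU : ∀ i, IsOpen (U i)) (hcov : (⋃ i, U i) = Set.univ)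
    (s : Simplex n A) (i : Fin k) (y : stdSimplex ℝ (Fin (n + 1))) :
    0 < coverWeight U s i y ↔ s y ∈ U i := by
  rw [coverWeight, div_pos_iff_of_pos_right (sum_one_sub_contact_pos hU hcov s y),
    one_sub_contact_pos_iff hU]

theorem coverWeight_mem_stdSimplex {n : ℕ} (hU : ∀ i, IsOpen (U i))
    (hcov : (⋃ i, U i) = Set.univ) (s : Simplex n A) (y : stdSimplex ℝ (Fin (n + 1))) :
    (fun i => coverWeight U s i y) ∈ stdSimplex ℝ (Fin k) := by
  have h := sum_one_sub_contact_pos hU hcov s y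
  refine ⟨fun i => div_nonneg (sub_nonneg.2 (contact_le_one _ _)) h.le, ?_⟩
  simp only [coverWeight]
  rw [← Finset.sum_div, div_self h.ne']

theorem continuous_coverWeight {n : ℕ} (hU : ∀ i, IsOpen (U i)) (hcov : (⋃ i, U i) = Set.univ)
    (s : Simplex n A) (i : Fin k) : Continuous (coverWeight U s i) := by
  have h : ∀ j, Continuous (contact (s ⁻¹' (U j)ᶜ)) := fun j =>
    continuous_contact ((hU j).isClosed_compl.preimage s.continuous)
  exact (continuous_const.sub (h i)).div
    (continuous_finsetSum _ fun j _ => continuous_const.sub (h j))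
    fun y => (sum_one_sub_contact_pos hU hcov s y).ne'

theorem coverWeight_comp_coface {n : ℕ} (hU : ∀ i, IsOpen (U i)) (s : Simplex (n + 1) A)
    (l : Fin (n + 2)) (i : Fin k) (y : stdSimplex ℝ (Fin (n + 1))) :
    coverWeight U (s.comp (coface l)) i y = coverWeight U s i (coface l y) := by
  have h : ∀ j, contact (s.comp (coface l) ⁻¹' (U j)ᶜ) y = contact (s ⁻¹' (U j)ᶜ) (coface l y) :=
    fun j => (contact_map Fin.succAbove_right_injective
      ((hU j).isClosed_compl.preimage s.continuous) y).symm
  simp only [coverWeight, h]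

theorem exists_simplex_lift {f : C(A, B)} {p : C(E, B)}
    (h : HasSectionalCover (pullbackMap f p) k) :
    ∃ Φ : ∀ n, Simplex n A → Simplex n (FibredJoin p k),
      (∀ n (s : Simplex (n + 1) A) i,
        Φ n (s.comp (coface i)) = (Φ (n + 1) s).comp (coface i)) ∧
      ∀ n (s : Simplex n A), (joinMap p k).comp (Φ n s) = f.comp s := by
  classical
  obtain ⟨U, hU, hcov, hs⟩ := hasSectionalCover_pullback_iff.1 h
  choose σ hσ using hs
  have hfib : ∀ a, ∃ e, p e = f a := fun a => by
    obtain ⟨i, hi⟩ := Set.mem_iUnion.1 (hcov ▸ Set.mem_univ a)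
    exact ⟨σ i ⟨a, hi⟩, hσ i ⟨a, hi⟩⟩
  choose e₀ he₀ using hfib
  -- Outside `U i` the weight is zero, so any point of the right fibre serves. The choice depends on
  -- the point of `A` alone, not on the simplex through it, so it agrees on faces.
  let ε : A → Fin k → E := fun a i => if ha : a ∈ U i then σ i ⟨a, ha⟩ else e₀ a
  have hεU : ∀ a i (ha : a ∈ U i), ε a i = σ i ⟨a, ha⟩ := fun a i ha => dif_pos ha
  have hε : ∀ a i, p (ε a i) = f a := fun a i => by
    by_cases ha : a ∈ U i
    · rw [hεU a i ha, hσ]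
    · simpa only [ε, ha, dif_neg, not_false_eq_true] using he₀ a
  let pre : ∀ n, Simplex n A → stdSimplex ℝ (Fin (n + 1)) → PreJoin p k := fun n s y =>
    ⟨(ε (s y), ⟨fun i => coverWeight U s i y, coverWeight_mem_stdSimplex hU hcov s y⟩),
      fun i j => (hε _ i).trans (hε _ j).symm⟩
  let toJoin : PreJoin p k → FibredJoin p k := Quotient.mk (joinSetoid p k)
  have hcont : ∀ n (s : Simplex n A),
      Continuous (toJoin ∘ pre n s) := by
    intro n s
    -- Only subbasic open sets need checking, so the discontinuity of `ε` off `U i` is harmless.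
    refine continuous_generateFrom_iff.2 ?_
    rintro _ (⟨i, V, hV, rfl⟩ | ⟨i, W, hW, rfl⟩)
    · exact hV.preimage (continuous_coverWeight hU hcov s i)
    · have hW' : IsOpen (Subtype.val '' (σ i ⁻¹' W)) :=
        (hU i).isOpenMap_subtype_val _ (hW.preimage (σ i).continuous)
      convert hW'.preimage s.continuous using 1
      ext y
      constructor
      · rintro ⟨⟨z, hz⟩, hzW, hzy⟩
        cases hzy
        have hy : s y ∈ U i := (coverWeight_pos_iff hU hcov s i y).1 hz
        refine ⟨⟨s y, hy⟩, ?_, rfl⟩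
        change σ i ⟨s y, hy⟩ ∈ W
        rw [← hεU _ _ hy]
        exact hzW
      · rintro ⟨⟨a, ha⟩, haW, rfl⟩
        refine ⟨⟨toJoin (pre n s y), (coverWeight_pos_iff hU hcov s i y).2 ha⟩, ?_, rfl⟩
        change ε (s y) i ∈ W
        rw [hεU _ _ ha]
        exact haW
  refine ⟨fun n s => ⟨_, hcont n s⟩, fun n s l => ContinuousMap.ext fun y => ?_,
    fun n s => ContinuousMap.ext fun y => ?_⟩
  · refine congrArg toJoin (Subtype.ext (Prod.ext rfl (Subtype.ext ?_)))
    funext i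
    exact coverWeight_comp_coface hU s l i y
  · exact hε _ _

theorem totalMap_eq_zero_of_genus_le {R : Type*} [CommRing R] {f : C(A, B)} {p : C(E, B)}
    (hf : genus (pullbackMap f p) ≤ k) (x : TotalCohomology R B)
    (hx : totalMap R (joinMap p k) x = 0) : totalMap R f x = 0 := by
  obtain ⟨Φ, hface, hlift⟩ := exists_simplex_lift (genus_le_iff.1 hf)
  exact totalMap_eq_zero_of_simplex_lift f (joinMap p k) Φ hface hlift x hx

end SimplexLift

/-! ### The weight in terms of joins, and the case of weight at least one -/

theorem forall_genus_le_iff {R : Type w} [CommRing R] {E B : Type u} [TopologicalSpace E]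
    [TopologicalSpace B] (p : C(E, B)) (x : TotalCohomology R B) (k : ℕ) :
    (∀ (A : Type u) [TopologicalSpace A] (f : C(A, B)),
      genus (pullbackMap f p) ≤ k → totalMap R f x = 0) ↔ totalMap R (joinMap p k) x = 0 :=
  ⟨fun h => h _ _ (genus_le_iff.2 (hasSectionalCover_joinMap p k)),
    fun h _ _ _ hf => totalMap_eq_zero_of_genus_le hf x h⟩

theorem one_le_weight_iff {R : Type w} [CommRing R] {E B : Type u} [TopologicalSpace E]
    [TopologicalSpace B] (p : C(E, B)) (x : TotalCohomology R B) :
    1 ≤ weight p x ↔ totalMap R p x = 0 := by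
  constructor
  · intro h
    obtain ⟨_, ⟨k, rfl, hk⟩, h1⟩ := lt_sSup_iff.1 (zero_lt_one.trans_le h)
    -- The test map is `p` itself: it lifts through `p` by the identity, so its pull-back has genus
    -- at most `1`, and `1 ≤ k`.
    refine hk E p (genus_le_iff.2 (HasSectionalCover.mono (Nat.cast_pos.1 h1)
      (hasSectionalCover_one_iff.2 ⟨ContinuousMap.id E, rfl⟩)))
  · intro h
    refine le_sSup ⟨1, Nat.cast_one.symm, fun A _ f hf => ?_⟩
    obtain ⟨g, rfl⟩ := hasSectionalCover_one_iff.1 (genus_le_iff.1 hf)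
    exact totalMap_comp_eq_zero g p x h

end FibWeight

theorem proposition2p4 {R : Type w} [CommRing R] {E B : Type u}
    [TopologicalSpace E] [TopologicalSpace B] (p : C(E, B)) (hp : FibWeight.IsFibration p)
    (x : FibWeight.TotalCohomology R B) (hx : x ≠ 0) :
    FibWeight.weight p x =
        sSup {m : ℕ∞ | ∃ k : ℕ, m = k ∧ FibWeight.totalMap R (FibWeight.joinMap p k) x = 0} ∧
      (1 ≤ FibWeight.weight p x ↔ FibWeight.totalMap R p x = 0) := by
  refine ⟨?_, FibWeight.one_le_weight_iff p x⟩
  simp only [FibWeight.weight, FibWeight.forall_genus_le_iff]
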